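/- Let $n$ be a positive integer. Cars $1,\dots,n$ arrive one after the other at a one-way street with parking spaces $1,\dots,n$; car $k$ prefers space $\pi_k\in[n]=\{1,\dots,n\}$ and parks in the first vacant space among $\pi_k,\pi_k+1,\dots,n$, if there is one, and otherwise leaves. The sequence $\pi=(\pi_1,\dots,\pi_n)$ is a parking function if all $n$ cars are able to park; it then induces the permutation $\sigma\in S_n$ for which $\sigma_s$ is the number of the car that parked in space $s$, $s\in[n]$. Let $P_n^{\mathrm{park}}$ denote the distribution on $S_n$ of the permutation induced by a uniformly random parking function, and $E_n^{\mathrm{park}}$ the corresponding expectation. A position $i\in[n]$ is a left-to-right maximum of $\sigma\in S_n$ if $\sigma_i>\sigma_k$ for all $1\le k<i$; let $X_n^{\mathrm{LR\text{-}max}}(\sigma)$ be the number of left-to-right maxima of $\sigma$. (i) For all $1\le i\le j\le n$, $$P_n^{\mathrm{park}}\bigl(i\text{ is a left-to-right maximum and }\sigma_i=j\bigr)=\binom{j-1}{i-1}\,i^{\,i-1}\,(n-i+1)^{j-i-1}\Bigl(i\,(n-j)\,(n+1)^{-j}+(n+1)^{1-j}\Bigr).$$ (ii) $$E_n^{\mathrm{park}}X_n^{\mathrm{LR\text{-}max}}=\sum_{j=1}^n\sum_{i=1}^j\binom{j-1}{i-1}\,i^{\,i-1}\,(n-i+1)^{j-i-1}\Bigl(i\,(n-j)\,(n+1)^{-j}+(n+1)^{1-j}\Bigr).$$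 -/

import Mathlib

/-!
Spaces and cars are both indexed by `Fin n`; the element `k : Fin n` stands for the space or the car
with number `k + 1`.
-/

namespace Parking

/-- A state of the street: for every space, the car that is parked there (`none` if vacant). -/
abbrev Street (n : ℕ) : Type := Fin n → Option (Fin n)

/-- The vacant spaces that a car with preferred space `p` can reach. -/
def available {n : ℕ} (st : Street n) (p : Fin n) : Finset (Fin n) :=
  Finset.univ.filter (fun s => p ≤ s ∧ st s = none)

/-- Car `c` with preferred space `p` parks in the first vacant space at or after `p`; if there is
none, it leaves and the street is unchanged. -/
def parkCar {n : ℕ} (st : Street n) (c p : Fin n) : Street n :=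
  if h : (available st p).Nonempty then
    Function.update st ((available st p).min' h) (some c)
  else st

/-- The street after the first `k` cars, with preferences `π`, have tried to park. -/
def streetAfter {n : ℕ} (π : Fin n → Fin n) : ℕ → Street n
  | 0 => fun _ => none
  | k + 1 => if h : k < n then parkCar (streetAfter π k) ⟨k, h⟩ (π ⟨k, h⟩) else streetAfter π k

/-- The street after all `n` cars have tried to park. -/
def finalStreet {n : ℕ} (π : Fin n → Fin n) : Street n := streetAfter π n

/-- `π` is a parking function if all cars are able to park. -/
def IsParkingFunction {n : ℕ} (π : Fin n → Fin n) : Prop :=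
  ∀ c : Fin n, ∃ s : Fin n, finalStreet π s = some c

instance {n : ℕ} (π : Fin n → Fin n) : Decidable (IsParkingFunction π) :=
  inferInstanceAs (Decidable (∀ c : Fin n, ∃ s : Fin n, finalStreet π s = some c))

/-- The set of parking functions on `[n]`. -/
abbrev ParkingFunction (n : ℕ) : Type := {π : Fin n → Fin n // IsParkingFunction π}

theorem isSome_finalStreet {n : ℕ} {π : Fin n → Fin n} (h : IsParkingFunction π) (s : Fin n) :
    (finalStreet π s).isSome := by
  choose f hf using h
  have hinj : Function.Injective f := fun a b hab =>
    Option.some_injective _ (by rw [← hf a, ← hf b, hab])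
  obtain ⟨c, rfl⟩ := (Finite.injective_iff_surjective.mp hinj) s
  simp [hf c]

/-- The car that is parked in space `s` in the end. -/
def carAt {n : ℕ} (π : ParkingFunction n) (s : Fin n) : Fin n :=
  (finalStreet π.1 s).get (isSome_finalStreet π.2 s)

theorem carAt_bijective {n : ℕ} (π : ParkingFunction n) : Function.Bijective (carAt π) := by
  refine Finite.surjective_iff_bijective.mp fun c => ?_
  obtain ⟨s, hs⟩ := π.2 c
  exact ⟨s, by simp [carAt, hs]⟩

/-- The permutation `σ` induced by a parking function: `σ s` is the car that parked in space `s`. -/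
noncomputable def toPerm {n : ℕ} (π : ParkingFunction n) : Equiv.Perm (Fin n) :=
  Equiv.ofBijective (carAt π) (carAt_bijective π)

theorem streetAfter_id {n : ℕ} (k : ℕ) (hk : k ≤ n) (s : Fin n) :
    streetAfter (fun c : Fin n => c) k s = if (s : ℕ) < k then some s else none := by
  induction k generalizing s with
  | zero => simp [streetAfter]
  | succ k ih =>
    have hkn : k < n := hk
    have ih' := fun s => ih hkn.le s
    have hmem : (⟨k, hkn⟩ : Fin n) ∈ available (streetAfter (fun c : Fin n => c) k) ⟨k, hkn⟩ := by
      simp [available, ih']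
    have hmin : (available (streetAfter (fun c : Fin n => c) k) ⟨k, hkn⟩).min' ⟨_, hmem⟩
        = ⟨k, hkn⟩ := by
      apply le_antisymm (Finset.min'_le _ _ hmem)
      apply Finset.le_min'
      intro y hy
      exact (Finset.mem_filter.mp hy).2.1
    rw [streetAfter, dif_pos hkn, parkCar, dif_pos ⟨_, hmem⟩, hmin, Function.update_apply]
    by_cases hs : s = ⟨k, hkn⟩
    · subst hs
      simp
    · have : (s : ℕ) ≠ k := fun h => hs (Fin.ext h)
      rw [if_neg hs, ih']
      by_cases h : (s : ℕ) < k
      · rw [if_pos h, if_pos (by omega)]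
      · rw [if_neg h, if_neg (by omega)]

instance (n : ℕ) : Nonempty (ParkingFunction n) :=
  ⟨⟨fun c => c, fun c => ⟨c, by simp [finalStreet, streetAfter_id]⟩⟩⟩

/-- The distribution on permutations induced by a uniformly random parking function. -/
noncomputable def parkPMF (n : ℕ) : PMF (Equiv.Perm (Fin n)) :=
  (PMF.uniformOfFintype (ParkingFunction n)).map toPerm

/-- All sets of permutations are events. -/
instance (n : ℕ) : MeasurableSpace (Equiv.Perm (Fin n)) := ⊤

/-- The distribution induced by a uniformly random parking function, as a measure. -/
noncomputable def parkMeasure (n : ℕ) : MeasureTheory.Measure (Equiv.Perm (Fin n)) :=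
  (parkPMF n).toMeasure

/-- Position `i` is a left-to-right maximum of `σ`. -/
def IsLRMax {n : ℕ} (σ : Equiv.Perm (Fin n)) (i : Fin n) : Prop :=
  ∀ k : Fin n, k < i → σ k < σ i

instance {n : ℕ} (σ : Equiv.Perm (Fin n)) (i : Fin n) : Decidable (IsLRMax σ i) :=
  inferInstanceAs (Decidable (∀ k : Fin n, k < i → σ k < σ i))

/-- The number of left-to-right maxima of `σ`. -/
def lrMaxCount {n : ℕ} (σ : Equiv.Perm (Fin n)) : ℕ :=
  (Finset.univ.filter (fun i : Fin n => IsLRMax σ i)).card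

end Parking

namespace Parking

open Finset

/-! Car `j` ends in space `i` as a left-to-right maximum exactly when, on its arrival, the spaces
before `i` are full, `i` is vacant, and its preference is at most `i` (`isLRMax_toPerm_iff`).
Counting the cars that fill occupied blocks turns this into inequalities on the preferences alone
(`isRecordPref_iff`).

These inequalities decouple along the set `L` of cars preferring a space up to `i`. In 1-based
numbering: the cars of `L` before `j` are `i - 1` in number and park on `i - 1` spaces; car `j` and
the later cars of `L` choose freely among `i` spaces; the cars outside `L` must fit into the `n - i`
spaces after `i`. Since `m ≤ N + 1` cars can park on `N` spaces in `(N + 1 - m) (N + 1)^(m - 1)`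
ways (`card_isPark`), `k` later cars in `L` contribute a factor `k + 1`. Summing this weight against
a binomial expansion (`sum_choose_mul_succ`) gives the two summands of the formula, and dividing by
the `(n + 1)^(n - 1)` parking functions gives (i). Part (ii) is linearity of expectation. -/

/-! ### Counting preferences of cars that can park -/

/-- The counting criterion for cars with preferences `f` to be able to park in the spaces
`0, …, N - 1`: for every `t`, the cars that prefer a space `≥ t` fit into the spaces `≥ t`. -/
def IsPark {α : Type*} [Fintype α] (N : ℕ) (f : α → ℕ) : Prop :=
  ∀ t ≤ N, t + #{x | t ≤ f x} ≤ N

theorem card_filter_subtype {α : Type*} [Fintype α] (p q : α → Prop) [DecidablePred p]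
    [DecidablePred q] [Fintype {x // p x}] : #{x : {x // p x} | q x.1} = #{x | p x ∧ q x} := by
  rw [← card_map (Function.Embedding.subtype p)]
  congr 1
  ext x
  simp [and_comm]

theorem IsPark.lt {α : Type*} [Fintype α] {N : ℕ} {f : α → ℕ} (h : IsPark N f) (x : α) :
    f x < N := by
  by_contra hx
  have h1 := h N le_rfl
  have : 0 < #{x | N ≤ f x} := card_pos.2 ⟨x, by simpa using hx⟩
  omega

theorem finite_of_forall_lt {α : Type*} [Finite α] (N : ℕ) {s : Set (α → ℕ)}
    (h : ∀ f ∈ s, ∀ x, f x < N) : s.Finite :=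
  (Set.Finite.pi' (fun _ : α => Set.finite_Iio N)).subset h

/-- Counting functions by the set `L` of points at which they take values below `M`. -/
theorem card_eq_sum_split {α : Type*} [Fintype α] [DecidableEq α] (M : ℕ) {s : Set (α → ℕ)}
    (hs : s.Finite) (u : ∀ L : Finset α, Set ({x // x ∈ L} → ℕ))
    (v : ∀ L : Finset α, Set ({x // x ∉ L} → ℕ))
    (hu : ∀ L, ∀ f ∈ u L, ∀ x, f x < M)
    (h : ∀ (f : α → ℕ) (L : Finset α), (∀ x, x ∈ L ↔ f x < M) →
      (f ∈ s ↔ (fun x : {x // x ∈ L} => f x) ∈ u L ∧ (fun x : {x // x ∉ L} => f x - M) ∈ v L)) :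
    Nat.card s = ∑ L : Finset α, Nat.card (u L) * Nat.card (v L) := by
  let g : (Σ L : Finset α, u L × v L) → (α → ℕ) := fun p x =>
    if hx : x ∈ p.1 then p.2.1.1 ⟨x, hx⟩ else p.2.2.1 ⟨x, hx⟩ + M
  have gpos : ∀ p x (hx : x ∈ p.1), g p x = p.2.1.1 ⟨x, hx⟩ := fun p x hx => dif_pos hx
  have gneg : ∀ p x (hx : x ∉ p.1), g p x = p.2.2.1 ⟨x, hx⟩ + M := fun p x hx => dif_neg hx
  have gL : ∀ p x, x ∈ p.1 ↔ g p x < M := by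
    intro p x
    by_cases hx : x ∈ p.1
    · simpa [hx, gpos p x hx] using hu _ _ p.2.1.2 ⟨x, hx⟩
    · simp [hx, gneg p x hx]
  have gs : ∀ p, g p ∈ s := by
    intro p
    refine (h (g p) p.1 (gL p)).2 ⟨?_, ?_⟩
    · convert p.2.1.2 using 1
      funext x
      exact gpos p x.1 x.2
    · convert p.2.2.2 using 1
      funext x
      simp [gneg p x.1 x.2]
  let e : (Σ L : Finset α, u L × v L) → s := fun p => ⟨g p, gs p⟩
  have he : Function.Bijective e := by
    constructor
    · intro p q hpq
      have hg : g p = g q := congrArg Subtype.val hpq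
      have hL : p.1 = q.1 := by
        ext x
        rw [gL p, gL q, hg]
      obtain ⟨L, a, b⟩ := p
      obtain ⟨L', a', b'⟩ := q
      obtain rfl : L = L' := hL
      congr 2
      · ext x
        have := congrFun hg x.1
        rwa [gpos _ _ x.2, gpos _ _ x.2] at this
      · ext x
        have := congrFun hg x.1
        rw [gneg _ _ x.2, gneg _ _ x.2] at this
        exact Nat.add_right_cancel this
    · rintro ⟨f, hf⟩
      have hL : ∀ x, x ∈ (univ.filter fun x => f x < M) ↔ f x < M := by simp
      obtain ⟨h1, h2⟩ := (h f _ hL).1 hf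
      refine ⟨⟨_, ⟨_, h1⟩, ⟨_, h2⟩⟩, Subtype.ext ?_⟩
      funext x
      by_cases hx : x ∈ (univ.filter fun x => f x < M)
      · exact gpos ⟨_, ⟨_, h1⟩, ⟨_, h2⟩⟩ x hx
      · refine (gneg ⟨_, ⟨_, h1⟩, ⟨_, h2⟩⟩ x hx).trans ?_
        have : M ≤ f x := by simpa using hx
        exact Nat.sub_add_cancel this
  have : Finite s := hs
  -- The injection into `s` makes every product finite, so `Nat.card` has no default value here.
  have hfin : Finite (Σ L : Finset α, u L × v L) := Finite.of_injective e he.1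
  have (L : Finset α) : Finite (u L × v L) := Finite.of_injective
    (fun p => (⟨L, p⟩ : Σ L : Finset α, u L × v L)) fun a b h => by simpa using h
  rw [← Nat.card_congr (Equiv.ofBijective e he), Nat.card_sigma]
  simp [Nat.card_prod]

/-- Functions that are constrained independently on `p` and off `p`. -/
theorem card_restrict_mul {α : Type*} (p : α → Prop) [DecidablePred p]
    (u : Set ({x // p x} → ℕ)) (v : Set ({x // ¬ p x} → ℕ)) :
    Nat.card {f : α → ℕ | (fun x : {x // p x} => f x) ∈ u ∧ (fun x : {x // ¬ p x} => f x) ∈ v} =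
      Nat.card u * Nat.card v := by
  rw [← Nat.card_prod]
  refine Nat.card_congr (((Equiv.piEquivPiSubtypeProd p (fun _ => ℕ)).subtypeEquiv
    (q := fun q => q.1 ∈ u ∧ q.2 ∈ v) fun f => Iff.rfl).trans Equiv.subtypeProdEquivProd)

theorem card_forall_lt {α : Type*} [Fintype α] (M : ℕ) :
    Nat.card {f : α → ℕ | ∀ x, f x < M} = M ^ Fintype.card α := by
  have e : {f : α → ℕ | ∀ x, f x < M} ≃ (α → {k : ℕ // k < M}) :=
    Equiv.subtypePiEquivPi (p := fun _ k => k < M)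
  rw [Nat.card_congr e, Nat.card_fun,
    Nat.card_congr (Fin.equivSubtype (n := M)).symm]
  simp

/-- The binomial theorem differentiated in `x`; termwise, the absorption identity for binomial
coefficients. -/
theorem sum_choose_mul_pow_sub_one (r : ℕ) (x y : ℝ) :
    ∑ k ∈ range (r + 1), (r.choose k : ℝ) * (k * x ^ (k - 1) * y ^ (r - k)) =
      r * (x + y) ^ (r - 1) := by
  cases r with
  | zero => simp
  | succ r =>
    rw [sum_range_succ', add_pow, mul_sum]
    simp only [Nat.cast_zero, zero_mul, mul_zero, add_zero, Nat.add_sub_cancel]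
    refine sum_congr rfl fun k _ => ?_
    have := congrArg (Nat.cast (R := ℝ)) (Nat.add_one_mul_choose_eq r k)
    push_cast at this ⊢
    linear_combination -(x ^ k * y ^ (r - k)) * this

theorem sum_choose_mul_card (r : ℕ) (x : ℝ) :
    ∑ k ∈ range (r + 1), (r.choose k : ℝ) * (x ^ k - k * x ^ (k - 1)) =
      (x + 1) ^ r - r * (x + 1) ^ (r - 1) := by
  have h1 := sum_choose_mul_pow_sub_one r x 1
  have h2 := add_pow x 1 r
  simp only [one_pow, mul_one] at h1 h2
  rw [← h1, h2, ← sum_sub_distrib]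
  exact sum_congr rfl fun k _ => by ring

/-- Induction on `N`: splitting off the cars that prefer space `0` leaves the criterion for one
space fewer, and `sum_choose_mul_card` sums the result. The bound is `N + 1` rather than `N` because
the formula correctly gives `0` there; the induction needs this case when no car prefers space `0`.
-/
theorem card_isPark (N : ℕ) : ∀ {α : Type} [Fintype α], Fintype.card α ≤ N + 1 →
    (Nat.card {f : α → ℕ | IsPark N f} : ℝ) =
      ((N : ℝ) + 1) ^ Fintype.card α - Fintype.card α * ((N : ℝ) + 1) ^ (Fintype.card α - 1) := by
  induction N with
  | zero =>
    intro α _ hα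
    rcases Nat.eq_zero_or_pos (Fintype.card α) with h0 | h0
    · have := Fintype.card_eq_zero_iff.1 h0
      have : {f : α → ℕ | IsPark 0 f} = Set.univ := by
        ext f; simp [IsPark]
      rw [this]
      simp
    · have : {f : α → ℕ | IsPark 0 f} = ∅ := by
        obtain ⟨x⟩ := Fintype.card_pos_iff.1 h0
        ext f
        simpa using fun h : IsPark 0 f => absurd (h.lt x) (by simp)
      have h1 : Fintype.card α = 1 := by omega
      rw [this, h1]
      simp
  | succ N ih =>
    intro α _ hα
    classical
    rcases Nat.lt_or_ge (N + 1) (Fintype.card α) with h0 | h0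
    · have : {f : α → ℕ | IsPark (N + 1) f} = ∅ := by
        ext f
        simp only [Set.mem_ofPred_eq, Set.mem_empty_iff_false, iff_false]
        intro h
        have := h 0 (Nat.zero_le _)
        simp at this
        omega
      have h1 : Fintype.card α = N + 2 := by omega
      rw [this, h1]
      simp
      ring
    · rw [card_eq_sum_split 1
        (finite_of_forall_lt (N + 1) (s := {f : α → ℕ | IsPark (N + 1) f}) fun f h x => h.lt x)
        (fun L => {f | ∀ x, f x < 1}) (fun L => {f | IsPark N f}) (fun L f h => h)]
      · push_cast
        have key : ∀ L : Finset α, (Nat.card {f : {x // x ∈ L} → ℕ | ∀ x, f x < 1} : ℝ) *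
            Nat.card {f : {x // x ∉ L} → ℕ | IsPark N f} =
            ((N : ℝ) + 1) ^ #Lᶜ - #Lᶜ * ((N : ℝ) + 1) ^ (#Lᶜ - 1) := by
          intro L
          have hc : Fintype.card {x // x ∉ L} = #Lᶜ := by
            rw [Fintype.card_subtype]; congr 1; ext; simp
          rw [card_forall_lt, ih (by rw [hc]; exact (card_le_univ _).trans h0), hc]
          simp
        -- The summand depends only on the size of the complement, so the sum is taken over
        -- complements and then by cardinality.
        rw [sum_congr rfl fun L _ => key L,
          ← (Equiv.sum_comp (compl_involutive (α := Finset α)).toPerm)]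
        simp only [Function.Involutive.coe_toPerm, compl_compl]
        rw [← powerset_univ, sum_powerset_apply_card
          (fun k => ((N : ℝ) + 1) ^ k - k * ((N : ℝ) + 1) ^ (k - 1))]
        simp only [nsmul_eq_mul]
        rw [sum_choose_mul_card, card_univ]
      · intro f L hL
        have hz : ∀ x ∈ L, f x < 1 := fun x hx => (hL x).1 hx
        have hc : ∀ t, #{x : {x // x ∉ L} | t ≤ f x - 1} = #{x | t + 1 ≤ f x} := by
          intro t
          rw [card_filter_subtype (fun x => x ∉ L) (fun x => t ≤ f x - 1)]
          congr 1
          ext x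
          simp [hL]
          omega
        constructor
        · intro h
          refine ⟨fun x => hz _ x.2, fun t ht => ?_⟩
          have := h (t + 1) (by omega)
          rw [hc]
          omega
        · rintro ⟨-, h⟩ t ht
          rcases t with _ | t
          · simpa using h0
          · have := h t (by omega)
            rw [hc] at this
            omega

/-! ### Occupied blocks of the street and vacancy criteria -/

section Street

variable {n : ℕ} (π : Fin n → Fin n)

theorem streetAfter_succ (k : Fin n) :
    streetAfter π (k + 1) = parkCar (streetAfter π k) k (π k) := by
  simp [streetAfter]

theorem parkCar_eq_some_iff (st : Street n) (c p s d : Fin n) :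
    parkCar st c p s = some d ↔ st s = some d ∨
      (c = d ∧ st s = none ∧ p ≤ s ∧ ∀ t, p ≤ t → t < s → st t ≠ none) := by
  unfold parkCar
  split_ifs with h
  · set m := (available st p).min' h with hm
    have hmem : p ≤ m ∧ st m = none := by
      have := min'_mem _ h
      rw [← hm] at this
      simpa only [available, mem_filter, mem_univ, true_and] using this
    have hmin : ∀ t, p ≤ t → st t = none → m ≤ t := fun t h1 h2 =>
      min'_le _ _ (by simp [available, h1, h2])
    by_cases hs : s = m
    · subst hs
      simp only [Function.update_self, Option.some.injEq, hmem, reduceCtorEq, false_or, true_and]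
      constructor
      · rintro rfl
        exact ⟨rfl, fun t h1 h2 h3 => absurd (hmin t h1 h3) (not_le.2 h2)⟩
      · exact fun h => h.1
    · rw [Function.update_of_ne hs]
      constructor
      · exact Or.inl
      · rintro (h1 | ⟨-, h1, h2, h3⟩)
        · exact h1
        · exact absurd hmem.2 (h3 m hmem.1 (lt_of_le_of_ne (hmin s h2 h1) (Ne.symm hs)))
  · constructor
    · exact Or.inl
    · rintro (h1 | ⟨-, h1, h2, h3⟩)
      · exact h1
      · exact absurd ⟨s, by simp [available, h1, h2]⟩ h

theorem streetAfter_succ_eq_some_iff (k s d : Fin n) :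
    streetAfter π (k + 1) s = some d ↔ streetAfter π k s = some d ∨
      (k = d ∧ streetAfter π k s = none ∧ π k ≤ s ∧
        ∀ t, π k ≤ t → t < s → streetAfter π k t ≠ none) := by
  rw [streetAfter_succ, parkCar_eq_some_iff]

theorem streetAfter_mono {k l : ℕ} (hkl : k ≤ l) {s c : Fin n}
    (h : streetAfter π k s = some c) : streetAfter π l s = some c := by
  induction l, hkl using Nat.le_induction with
  | base => exact h
  | succ l _ ih =>
    by_cases hl : l < n
    · exact (streetAfter_succ_eq_some_iff π ⟨l, hl⟩ s c).2 (Or.inl ih)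
    · simpa [streetAfter, hl] using ih

/-- A parked car found all spaces between its preference and its space occupied by earlier cars. -/
theorem streetAfter_eq_some {k : ℕ} {s c : Fin n} (h : streetAfter π k s = some c) :
    (c : ℕ) < k ∧ streetAfter π c s = none ∧ π c ≤ s ∧
      ∀ t, π c ≤ t → t < s → streetAfter π c t ≠ none := by
  induction k with
  | zero => simp [streetAfter] at h
  | succ k ih =>
    by_cases hk : k < n
    · rcases (streetAfter_succ_eq_some_iff π ⟨k, hk⟩ s c).1 h with h | ⟨rfl, h'⟩
      · exact ⟨(ih h).1.trans (Nat.lt_succ_self k), (ih h).2⟩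
      · exact ⟨Nat.lt_succ_self k, h'⟩
    · have h' : streetAfter π k s = some c := by simpa [streetAfter, hk] using h
      exact ⟨(ih h').1.trans (Nat.lt_succ_self k), (ih h').2⟩

theorem streetAfter_ne_none_mono {k l : ℕ} (hkl : k ≤ l) {s : Fin n}
    (h : streetAfter π k s ≠ none) : streetAfter π l s ≠ none := by
  obtain ⟨c, hc⟩ := Option.ne_none_iff_exists'.1 h
  simp [streetAfter_mono π hkl hc]

theorem occupied_between {k : ℕ} {s c t : Fin n} (h : streetAfter π k s = some c)
    (h1 : π c ≤ t) (h2 : t ≤ s) : streetAfter π k t ≠ none := by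
  rcases h2.eq_or_lt with rfl | h2
  · simp [h]
  · obtain ⟨a, -, -, b⟩ := streetAfter_eq_some π h
    exact streetAfter_ne_none_mono π a.le (b t h1 h2)

theorem streetAfter_injective {k : ℕ} {s t c : Fin n} (hs : streetAfter π k s = some c)
    (ht : streetAfter π k t = some c) : s = t := by
  obtain ⟨-, a, b, d⟩ := streetAfter_eq_some π hs
  obtain ⟨-, a', b', d'⟩ := streetAfter_eq_some π ht
  rcases lt_trichotomy s t with h | h | h
  · exact absurd a (d' s b h)
  · exact h
  · exact absurd a' (d t b' h)

/-- A car parks if some space at or after its preference is vacant later on. -/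
theorem exists_parked_of_vacant {k : ℕ} {c s : Fin n} (hc : (c : ℕ) < k) (hs : π c ≤ s)
    (h : streetAfter π k s = none) : ∃ t < s, π c ≤ t ∧ streetAfter π k t = some c := by
  have h0 : streetAfter π c s = none := by
    by_contra h'
    exact streetAfter_ne_none_mono π hc.le h' h
  have hne : (univ.filter fun t => π c ≤ t ∧ streetAfter π c t = none).Nonempty :=
    ⟨s, by simp [hs, h0]⟩
  obtain ⟨t, ht, hmin⟩ := exists_min_image _ id hne
  simp only [mem_filter, mem_univ, true_and, id_eq, and_imp] at ht hmin
  have h1 : streetAfter π k t = some c := by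
    refine streetAfter_mono π hc ((streetAfter_succ_eq_some_iff π c t c).2 (Or.inr
      ⟨rfl, ht.2, ht.1, fun r h1 h2 h3 => absurd (hmin r h1 h3) (not_le.2 h2)⟩))
  refine ⟨t, lt_of_le_of_ne (hmin s hs h0) ?_, ht.1, h1⟩
  rintro rfl
  simp [h] at h1

/-- A block of occupied spaces `[t, u)` that starts at `0` or after a vacant space is filled by cars
which prefer a space of the block. -/
theorem card_block_le {k : ℕ} {t u : ℕ} (hu : u ≤ n)
    (hocc : ∀ r : Fin n, t ≤ r → r < u → streetAfter π k r ≠ none)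
    (hvac : ∀ r : Fin n, (r : ℕ) + 1 = t → streetAfter π k r = none) :
    u - t ≤ #{c : Fin n | ∃ s : Fin n, s < u ∧ streetAfter π k s = some c ∧
      t ≤ (π c : ℕ) ∧ π c ≤ s} := by
  have hex : ∀ r : Fin n, ∃ c, t ≤ r → (r : ℕ) < u → streetAfter π k r = some c := by
    intro r
    by_cases h : t ≤ r ∧ (r : ℕ) < u
    · obtain ⟨c, hc⟩ := Option.ne_none_iff_exists'.1 (hocc r h.1 h.2)
      exact ⟨c, fun _ _ => hc⟩
    · exact ⟨r, fun h1 h2 => absurd ⟨h1, h2⟩ h⟩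
  choose f hf using hex
  have hcard : #{r : Fin n | t ≤ r ∧ (r : ℕ) < u} = u - t := by
    rw [← Nat.card_Ico, ← card_map Fin.valEmbedding]
    congr 1
    ext r
    simp only [mem_map, mem_filter, mem_univ, true_and, Fin.valEmbedding_apply, mem_Ico]
    exact ⟨by rintro ⟨a, h, rfl⟩; exact h, fun h => ⟨⟨r, by omega⟩, h, rfl⟩⟩
  rw [← hcard]
  refine card_le_card_of_injOn f ?_ ?_
  · intro r hr
    simp only [coe_filter, mem_univ, true_and, Set.mem_ofPred_eq] at hr ⊢
    have h := hf r hr.1 hr.2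
    have hle := (streetAfter_eq_some π h).2.2.1
    refine ⟨r, hr.2, h, ?_, hle⟩
    -- A car preferring a space before `t` would have found space `t - 1` occupied, but that space
    -- is vacant.
    by_contra hlt
    have ht : t - 1 < n := by omega
    refine occupied_between π h (t := ⟨t - 1, ht⟩) ?_ ?_ (hvac _ ?_)
    · rw [Fin.le_def]; dsimp only; omega
    · rw [Fin.le_def]; dsimp only; omega
    · dsimp only; omega
  · intro r hr r' hr' heq
    simp only [coe_filter, mem_univ, true_and, Set.mem_ofPred_eq] at hr hr'
    exact streetAfter_injective π (hf r hr.1 hr.2) (heq ▸ hf r' hr'.1 hr'.2)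

/-- The occupied block that ends just before `u`. -/
theorem exists_block (k u : ℕ) : ∃ t ≤ u,
    (∀ r : Fin n, t ≤ r → r < u → streetAfter π k r ≠ none) ∧
    (∀ r : Fin n, (r : ℕ) + 1 = t → streetAfter π k r = none) := by
  have hex : ∃ t, t ≤ u ∧ ∀ r : Fin n, t ≤ r → r < u → streetAfter π k r ≠ none :=
    ⟨u, le_rfl, fun r h1 h2 => absurd h2 (not_lt.2 h1)⟩
  classical
  refine ⟨Nat.find hex, (Nat.find_spec hex).1, (Nat.find_spec hex).2, fun r hr => ?_⟩
  by_contra hne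
  -- Were the space before the block occupied, it would extend the block, against minimality.
  refine Nat.find_min hex (m := r) (by omega) ⟨?_, fun r' h1 h2 => ?_⟩
  · have := (Nat.find_spec hex).1
    omega
  · rcases h1.eq_or_lt with h | h
    · rwa [← Fin.ext h]
    · exact (Nat.find_spec hex).2 r' (by omega) h2

/-- If `s` is vacant, the cars which prefer a space in `[t, s]` are parked in `[t, s)`. -/
theorem card_le_of_vacant {k : ℕ} {s : Fin n} (h : streetAfter π k s = none) (t : ℕ)
    (ht : t ≤ s) : t + #{c : Fin n | (c : ℕ) < k ∧ t ≤ (π c : ℕ) ∧ π c ≤ s} ≤ s := by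
  have hex : ∀ c : Fin n, ∃ r : Fin n, (c : ℕ) < k → π c ≤ s →
      r < s ∧ π c ≤ r ∧ streetAfter π k r = some c := by
    intro c
    by_cases hc : (c : ℕ) < k ∧ π c ≤ s
    · obtain ⟨r, hr⟩ := exists_parked_of_vacant π hc.1 hc.2 h
      exact ⟨r, fun _ _ => hr⟩
    · exact ⟨c, fun h1 h2 => absurd ⟨h1, h2⟩ hc⟩
  choose f hf using hex
  have : #{c : Fin n | (c : ℕ) < k ∧ t ≤ (π c : ℕ) ∧ π c ≤ s} ≤ #(Ico t (s : ℕ)) := by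
    refine card_le_card_of_injOn (fun c => (f c : ℕ)) ?_ ?_
    · intro c hc
      simp only [coe_filter, mem_univ, true_and, Set.mem_ofPred_eq] at hc
      obtain ⟨h1, h2, -⟩ := hf c hc.1 hc.2.2
      simp only [coe_Ico, Set.mem_Ico]
      exact ⟨hc.2.1.trans h2, h1⟩
    · intro c hc d hd hcd
      simp only [coe_filter, mem_univ, true_and, Set.mem_ofPred_eq] at hc hd
      have h1 := (hf c hc.1 hc.2.2).2.2
      have h2 := (hf d hd.1 hd.2.2).2.2
      rw [Fin.ext hcd, h2] at h1
      exact (Option.some_injective _ h1).symm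
  rw [Nat.card_Ico] at this
  omega

/-- If `s` is occupied, the maximal occupied block ending at `s` starts at some `t ≤ s` and holds `s
+ 1 - t` cars, all with preferences in `[t, s]`; this violates the inequality for that `t`. -/
theorem vacant_iff (k : ℕ) (s : Fin n) : streetAfter π k s = none ↔
    ∀ t : ℕ, t ≤ s → t + #{c : Fin n | (c : ℕ) < k ∧ t ≤ (π c : ℕ) ∧ π c ≤ s} ≤ s := by
  refine ⟨fun h t ht => card_le_of_vacant π h t ht, fun h => ?_⟩
  by_contra hne
  obtain ⟨t, ht, hocc, hvac⟩ := exists_block π k (s + 1)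
  have hts : t ≤ s := by
    by_contra hlt
    exact hne (hvac s (by omega))
  have h1 := card_block_le π (u := s + 1) s.2 hocc hvac
  have h2 := h t hts
  have h3 : #{c : Fin n | ∃ r : Fin n, (r : ℕ) < s + 1 ∧ streetAfter π k r = some c ∧
      t ≤ (π c : ℕ) ∧ π c ≤ r} ≤ #{c : Fin n | (c : ℕ) < k ∧ t ≤ (π c : ℕ) ∧ π c ≤ s} := by
    refine card_le_card fun c hc => ?_
    simp only [mem_filter, mem_univ, true_and] at hc ⊢
    obtain ⟨r, h1, h2, h3, h4⟩ := hc
    exact ⟨(streetAfter_eq_some π h2).1, h3, h4.trans (Nat.lt_succ_iff.1 h1)⟩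
  omega

/-- Parked cars preferring spaces from `t` on occupy distinct spaces from `t` on. Conversely, given
an unparked car, the inequality fails at the start of the occupied block ending the street: that car
and those filling the block are too many. -/
theorem isParkingFunction_iff : IsParkingFunction π ↔ IsPark n (fun c => (π c : ℕ)) := by
  constructor
  · intro h t ht
    choose f hf using h
    dsimp only
    have : #{c : Fin n | t ≤ (π c : ℕ)} ≤ #(Ico t n) := by
      refine card_le_card_of_injOn (fun c => (f c : ℕ)) ?_ ?_
      · intro c hc
        simp only [coe_filter, mem_univ, true_and, Set.mem_ofPred_eq] at hc
        simp only [coe_Ico, Set.mem_Ico]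
        exact ⟨hc.trans (streetAfter_eq_some π (hf c)).2.2.1, (f c).2⟩
      · intro c _ d _ hcd
        have h1 := hf c
        rw [Fin.ext hcd, hf d] at h1
        exact (Option.some_injective _ h1).symm
    rw [Nat.card_Ico] at this
    omega
  · intro h c
    by_contra hne
    obtain ⟨t, ht, hocc, hvac⟩ := exists_block π n n
    have h1 := card_block_le π le_rfl hocc hvac
    have h2 := h t ht
    dsimp only at h2
    -- Otherwise car `c` could have reached the vacant space `t - 1`, and would have parked.
    have htc : t ≤ (π c : ℕ) := by
      by_contra hlt
      have ht' : t - 1 < n := by omega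
      obtain ⟨r, -, -, hr⟩ := exists_parked_of_vacant π (k := n) (s := ⟨t - 1, ht'⟩) c.2
        (by rw [Fin.le_def]; dsimp only; omega) (hvac _ (by dsimp only; omega))
      exact hne ⟨r, hr⟩
    have h3 : #{c : Fin n | ∃ r : Fin n, (r : ℕ) < n ∧ streetAfter π n r = some c ∧
        t ≤ (π c : ℕ) ∧ π c ≤ r} < #{c : Fin n | t ≤ (π c : ℕ)} := by
      refine card_lt_card ((ssubset_iff_of_subset fun d hd => ?_).2 ⟨c, ?_, fun hc => ?_⟩)
      · simp only [mem_filter, mem_univ, true_and] at hd ⊢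
        obtain ⟨r, -, -, h3, -⟩ := hd
        exact h3
      · simpa using htc
      · simp only [mem_filter, mem_univ, true_and] at hc
        obtain ⟨r, -, h3, -⟩ := hc
        exact hne ⟨r, h3⟩
    omega

/-- The counting criterion for `s` to be the first vacant space after `k` cars. -/
theorem first_vacant_iff (k : ℕ) (s : Fin n) :
    (streetAfter π k s = none ∧ ∀ r < s, streetAfter π k r ≠ none) ↔
    (∀ t : ℕ, t ≤ s → t + #{c : Fin n | (c : ℕ) < k ∧ t ≤ (π c : ℕ) ∧ π c ≤ s} ≤ s) ∧
      #{c : Fin n | (c : ℕ) < k ∧ π c ≤ s} = s := by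
  rw [← vacant_iff]
  refine and_congr_right fun hv => ?_
  have hle := card_le_of_vacant π hv 0 (Nat.zero_le _)
  simp only [Nat.zero_le, true_and, zero_add] at hle
  constructor
  · intro hocc
    refine le_antisymm hle ?_
    have h1 := card_block_le π (k := k) (t := 0) (u := s) s.2.le (fun r _ hr => hocc r hr)
      (fun r hr => absurd hr (by omega))
    refine h1.trans (card_le_card fun c hc => ?_)
    simp only [mem_filter, mem_univ, true_and] at hc ⊢
    obtain ⟨r, h1, h2, -, h4⟩ := hc
    exact ⟨(streetAfter_eq_some π h2).1, h4.trans (le_of_lt h1)⟩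
  · intro hcard
    have hex : ∀ c : Fin n, ∃ r : Fin n, (c : ℕ) < k → π c ≤ s →
        r < s ∧ π c ≤ r ∧ streetAfter π k r = some c := by
      intro c
      by_cases hc : (c : ℕ) < k ∧ π c ≤ s
      · obtain ⟨r, hr⟩ := exists_parked_of_vacant π hc.1 hc.2 hv
        exact ⟨r, fun _ _ => hr⟩
      · exact ⟨c, fun h1 h2 => absurd ⟨h1, h2⟩ hc⟩
    choose f hf using hex
    -- As many cars as there are spaces before `s` park there injectively, hence fill them all.
    have hsurj := surj_on_of_inj_on_of_card_le (s := {c : Fin n | (c : ℕ) < k ∧ π c ≤ s})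
      (t := Iio s) (fun c _ => f c)
      (fun c hc => by
        simp only [mem_filter, mem_univ, true_and] at hc
        exact mem_Iio.2 (hf c hc.1 hc.2).1)
      (fun c d hc hd hcd => by
        simp only [mem_filter, mem_univ, true_and] at hc hd
        have h1 := (hf c hc.1 hc.2).2.2
        have h2 := (hf d hd.1 hd.2).2.2
        rw [hcd, h2] at h1
        exact (Option.some_injective _ h1).symm)
      (by rw [hcard, Fin.card_Iio])
    intro r hr
    obtain ⟨c, hc, rfl⟩ := hsurj r (mem_Iio.2 hr)
    simp only [mem_filter, mem_univ, true_and] at hc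
    simp [(hf c hc.1 hc.2).2.2]

/-! ### Left-to-right maxima in terms of preferences -/

theorem toPerm_eq_iff (p : ParkingFunction n) (s c : Fin n) :
    toPerm p s = c ↔ streetAfter p.1 n s = some c := by
  change (finalStreet p.1 s).get _ = c ↔ _
  rw [← Option.some_inj, Option.some_get]
  rfl

/-- A space holds a car smaller than `J` in the end exactly when it is already occupied as car `J`
arrives. -/
theorem isLRMax_toPerm_iff (p : ParkingFunction n) (I J : Fin n) :
    (IsLRMax (toPerm p) I ∧ toPerm p I = J) ↔
      p.1 J ≤ I ∧ streetAfter p.1 J I = none ∧ ∀ r < I, streetAfter p.1 J r ≠ none := by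
  have early : ∀ {s c : Fin n}, toPerm p s = c → c < J → streetAfter p.1 J s = some c := by
    intro s c h hc
    have h1 := streetAfter_eq_some p.1 ((toPerm_eq_iff p s c).1 h)
    obtain ⟨d, hd⟩ := Option.ne_none_iff_exists'.1 (streetAfter_ne_none_mono p.1
      (k := c + 1) (l := J) hc (s := s) (by
        rw [(streetAfter_succ_eq_some_iff p.1 c s c).2 (Or.inr ⟨rfl, h1.2⟩)]; simp))
    rw [hd, ← h, (toPerm_eq_iff p s d).2 (streetAfter_mono p.1 J.2.le hd)]
  constructor
  · rintro ⟨h1, h2⟩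
    have h3 := streetAfter_eq_some p.1 ((toPerm_eq_iff p I J).1 h2)
    refine ⟨h3.2.2.1, h3.2.1, fun r hr => ?_⟩
    rw [early rfl (h2 ▸ h1 r hr)]
    simp
  · rintro ⟨h1, h2, h3⟩
    have h4 : toPerm p I = J := (toPerm_eq_iff p I J).2 (streetAfter_mono p.1 (k := J + 1) J.2
      ((streetAfter_succ_eq_some_iff p.1 J I J).2 (Or.inr ⟨rfl, h2, h1, fun t _ ht => h3 t ht⟩)))
    refine ⟨fun r hr => ?_, h4⟩
    obtain ⟨c, hc⟩ := Option.ne_none_iff_exists'.1 (h3 r hr)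
    rw [h4, (toPerm_eq_iff p r c).2 (streetAfter_mono p.1 J.2.le hc)]
    exact (streetAfter_eq_some p.1 hc).1

/-- The counting criterion for the preferences of a parking function that makes position `I` a
left-to-right maximum with value `J`. -/
def IsRecordPref (I J : Fin n) (f : Fin n → ℕ) : Prop :=
  f J ≤ I ∧ #{c : Fin n | c < J ∧ f c ≤ I} = I ∧
    (∀ t : ℕ, t ≤ I → t + #{c : Fin n | (c < J ∧ f c ≤ I) ∧ t ≤ f c} ≤ I) ∧
    ∀ t : ℕ, I < t → t ≤ n → t + #{c : Fin n | t ≤ f c} ≤ n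

theorem isRecordPref_iff (I J : Fin n) : IsRecordPref I J (fun c => (π c : ℕ)) ↔
    ∃ h : IsParkingFunction π, IsLRMax (toPerm ⟨π, h⟩) I ∧ toPerm ⟨π, h⟩ I = J := by
  simp only [isLRMax_toPerm_iff, exists_prop, first_vacant_iff, isParkingFunction_iff]
  have hset : ∀ t : ℕ, #{c : Fin n | (c : ℕ) < J ∧ t ≤ (π c : ℕ) ∧ π c ≤ I} =
      #{c : Fin n | (c < J ∧ (π c : ℕ) ≤ I) ∧ t ≤ (π c : ℕ)} := by
    intro t
    congr 1
    ext c
    simp only [mem_filter, mem_univ, true_and, Fin.lt_def, Fin.le_def]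
    tauto
  simp only [hset]
  constructor
  · rintro ⟨h1, h2, h3, h4⟩
    dsimp only at h1 h2 h3 h4
    refine ⟨fun t ht => ?_, h1, h3, h2⟩
    dsimp only
    rcases Nat.lt_or_ge I t with h | h
    · exact h4 t h ht
    · have h5 := h3 t h
      -- For `t ≤ I` the criterion is automatic: at most `I - t` of the `I` early cars prefer a
      -- space from `t` on, and only `n - I` other cars exist.
      have h6 := card_filter_add_card_filter_not (s := (univ : Finset (Fin n)))
        (fun c => c < J ∧ (π c : ℕ) ≤ I)
      rw [h2, card_univ, Fintype.card_fin] at h6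
      have h7 : #{c : Fin n | t ≤ (π c : ℕ)} ≤
          #{c : Fin n | (c < J ∧ (π c : ℕ) ≤ I) ∧ t ≤ (π c : ℕ)} +
          #{c : Fin n | ¬ (c < J ∧ (π c : ℕ) ≤ I)} := by
        refine (card_le_card fun c hc => ?_).trans (card_union_le _ _)
        simp only [mem_filter, mem_univ, true_and, mem_union] at hc ⊢
        tauto
      omega
  · rintro ⟨h1, h2, h3, h4⟩
    exact ⟨h2, h4, h3, fun t _ ht => h1 t ht⟩

end Street

/-! ### Counting the record configurations -/

/-- The integer exponent makes the product form valid without cars as well, where the exponent is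
`-1`. -/
theorem card_isPark_zpow (N : ℕ) {α : Type} [Fintype α] (h : Fintype.card α ≤ N + 1) :
    (Nat.card {f : α → ℕ | IsPark N f} : ℝ) =
      ((N : ℝ) + 1 - Fintype.card α) * ((N : ℝ) + 1) ^ ((Fintype.card α : ℤ) - 1) := by
  have hN : (N : ℝ) + 1 ≠ 0 := by positivity
  rw [card_isPark N h, sub_mul, zpow_sub_one₀ hN, zpow_natCast]
  rcases Nat.eq_zero_or_pos (Fintype.card α) with h0 | h0
  · simp [h0, hN]
  · obtain ⟨r, hr⟩ := Nat.exists_eq_add_one.2 h0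
    rw [hr, Nat.add_sub_cancel]
    field_simp
    ring

/-- Such an `L` consists of `J`, an `I`-subset of the cars before `J`, and an arbitrary set of `k`
cars after `J`. -/
theorem sum_filter_card_eq {n : ℕ} (I : ℕ) (J : Fin n) (g : ℕ → ℝ) :
    ∑ L : Finset (Fin n) with J ∈ L ∧ #{c ∈ L | c < J} = I, g #L =
      ((J : ℕ).choose I : ℝ) *
        ∑ k ∈ range (n - 1 - J + 1), ((n - 1 - J).choose k : ℝ) * g (I + 1 + k) := by
  have hK : ∑ K ∈ (Ioi J).powerset, g (I + 1 + #K) =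
      ∑ k ∈ range (n - 1 - J + 1), ((n - 1 - J).choose k : ℝ) * g (I + 1 + k) := by
    rw [sum_powerset_apply_card (fun k => g (I + 1 + k)), Fin.card_Ioi]
    simp only [nsmul_eq_mul]
  have hA : #(powersetCard I (Iio J)) = (J : ℕ).choose I := by
    rw [card_powersetCard, Fin.card_Iio]
  rw [← hK, ← hA, ← nsmul_eq_mul, ← sum_const, ← sum_product']
  refine sum_nbij' (fun L => ({c ∈ L | c < J}, {c ∈ L | J < c})) (fun p => insert J (p.1 ∪ p.2))
    ?_ ?_ ?_ ?_ ?_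
  · intro L hL
    simp only [mem_filter, mem_univ, true_and] at hL
    simp only [mem_product, mem_powersetCard, mem_powerset, hL.2, and_true]
    exact ⟨fun c hc => mem_Iio.2 (mem_filter.1 hc).2, fun c hc => mem_Ioi.2 (mem_filter.1 hc).2⟩
  · rintro ⟨A, K⟩ h
    simp only [mem_product, mem_powersetCard, mem_powerset] at h
    simp only [mem_filter, mem_univ, true_and, mem_insert_self]
    rw [← h.1.2]
    congr 1
    ext c
    have h1 : c ∈ A → c < J := fun hc => mem_Iio.1 (h.1.1 hc)
    have h2 : c ∈ K → J < c := fun hc => mem_Ioi.1 (h.2 hc)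
    simp only [mem_filter, mem_insert, mem_union]
    grind
  · intro L hL
    simp only [mem_filter, mem_univ, true_and] at hL
    ext c
    simp only [mem_filter, mem_insert, mem_union]
    rcases lt_trichotomy c J with h | h | h <;> grind
  · rintro ⟨A, K⟩ h
    simp only [mem_product, mem_powersetCard, mem_powerset] at h
    have h1 : ∀ c ∈ A, c < J := fun c hc => mem_Iio.1 (h.1.1 hc)
    have h2 : ∀ c ∈ K, J < c := fun c hc => mem_Ioi.1 (h.2 hc)
    refine Prod.ext ?_ ?_ <;> ext c <;> simp only [mem_filter, mem_insert, mem_union] <;> grind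
  · intro L hL
    simp only [mem_filter, mem_univ, true_and] at hL
    have h1 : L = insert J ({c ∈ L | c < J} ∪ {c ∈ L | J < c}) := by
      ext c
      simp only [mem_filter, mem_insert, mem_union]
      rcases lt_trichotomy c J with h | h | h <;> grind
    have h2 : #L = I + 1 + #{c ∈ L | J < c} := by
      conv_lhs => rw [h1]
      rw [card_insert_of_notMem (by simp), card_union_of_disjoint, hL.2]
      · ring
      · rw [disjoint_left]
        intro c hc hc'
        exact lt_asymm (mem_filter.1 hc).2 (mem_filter.1 hc').2
    rw [h2]

/-- The preferences `≤ I` in a record configuration, on the set `L` of the cars concerned. -/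
def recordLow {n : ℕ} (I J : Fin n) (L : Finset (Fin n)) : Set ({x // x ∈ L} → ℕ) :=
  {f | (∀ x, f x < I + 1) ∧ (J ∈ L ∧ #{c ∈ L | c < J} = I) ∧
    IsPark I (fun x : {x : {x // x ∈ L} // x.1 < J} => f x)}

theorem card_subtype_subtype_lt {n : ℕ} (J : Fin n) (L : Finset (Fin n)) :
    Fintype.card {x : {x // x ∈ L} // x.1 < J} = #{c ∈ L | c < J} := by
  rw [Fintype.card_subtype, card_filter_subtype (fun x => x ∈ L) (fun x => x < J)]
  congr 1
  ext
  simp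

/-- The cars of `L` before `J` form a parking function on `I` spaces, which already bounds their
preferences; the other `#L - I` cars choose freely among `I + 1` spaces. -/
theorem card_recordLow {n : ℕ} (I J : Fin n) (L : Finset (Fin n))
    (h : J ∈ L ∧ #{c ∈ L | c < J} = I) :
    (Nat.card (recordLow I J L) : ℝ) =
      ((I : ℝ) + 1) ^ ((I : ℤ) - 1) * ((I : ℝ) + 1) ^ (#L - I) := by
  have hset : recordLow I J L = {f : {x // x ∈ L} → ℕ |
      (fun x : {x : {x // x ∈ L} // x.1 < J} => f x) ∈
        {f : {x : {x // x ∈ L} // x.1 < J} → ℕ | IsPark I f} ∧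
      (fun x : {x : {x // x ∈ L} // ¬ x.1 < J} => f x) ∈
        {f : {x : {x // x ∈ L} // ¬ x.1 < J} → ℕ | ∀ x, f x < I + 1}} := by
    ext f
    constructor
    · rintro ⟨h1, -, h2⟩
      exact ⟨h2, fun x => h1 x⟩
    · rintro ⟨h1, h2⟩
      refine ⟨fun x => ?_, h, h1⟩
      by_cases hx : x.1 < J
      · exact (h1.lt ⟨x, hx⟩).trans (Nat.lt_succ_self _)
      · exact h2 ⟨x, hx⟩
  have hc := (card_subtype_subtype_lt J L).trans h.2
  rw [hset, card_restrict_mul, Nat.cast_mul, card_isPark_zpow _ (by rw [hc]; omega), hc,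
    card_forall_lt, Fintype.card_subtype_compl, hc, Fintype.card_coe]
  push_cast
  ring

theorem card_isRecordPref_eq_sum {n : ℕ} (I J : Fin n) :
    Nat.card {f : Fin n → ℕ | IsRecordPref I J f} =
      ∑ L : Finset (Fin n), Nat.card (recordLow I J L) *
        Nat.card {f : {x // x ∉ L} → ℕ | IsPark (n - 1 - I) f} := by
  refine card_eq_sum_split (I + 1) (finite_of_forall_lt n ?_) _ _ (fun L f h => h.1) ?_
  · rintro f ⟨-, -, -, h⟩ x
    by_contra hx
    have h1 := h n I.2 le_rfl
    have : 0 < #{x | n ≤ f x} := card_pos.2 ⟨x, by simpa using hx⟩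
    omega
  · intro f L hL
    have hI := I.2
    have e1 : #{c : Fin n | c < J ∧ f c ≤ I} = #{c ∈ L | c < J} := by
      congr 1
      ext c
      simp [hL, and_comm]
    have e2 : ∀ t : ℕ, #{x : {x : {x // x ∈ L} // x.1 < J} | t ≤ f x} =
        #{c : Fin n | (c < J ∧ f c ≤ I) ∧ t ≤ f c} := by
      intro t
      rw [card_filter_subtype (fun x : {x // x ∈ L} => x.1 < J) (fun x => t ≤ f x.1),
        card_filter_subtype (fun x => x ∈ L) (fun x => x < J ∧ t ≤ f x)]
      congr 1
      ext c
      simp only [mem_filter, mem_univ, true_and, hL, Nat.lt_succ_iff]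
      tauto
    have e3 : ∀ t : ℕ,
        #{x : {x // x ∉ L} | t ≤ f x - (I + 1)} = #{c : Fin n | t + (I + 1) ≤ f c} := by
      intro t
      rw [card_filter_subtype (fun x => x ∉ L) (fun x => t ≤ f x - (I + 1))]
      congr 1
      ext c
      simp only [mem_filter, mem_univ, true_and, hL]
      omega
    constructor
    · rintro ⟨h1, h2, h3, h4⟩
      refine ⟨⟨fun x => (hL _).1 x.2, ⟨(hL J).2 (Nat.lt_succ_iff.2 h1), e1 ▸ h2⟩,
        fun t ht => ?_⟩, fun t ht => ?_⟩
      · rw [e2]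
        exact h3 t ht
      · rw [e3]
        have := h4 (t + (I + 1)) (by omega) (by omega)
        omega
    · rintro ⟨⟨-, ⟨h1, h2⟩, h3⟩, h4⟩
      refine ⟨Nat.lt_succ_iff.1 ((hL J).1 h1), e1.trans h2, fun t ht => ?_, fun t h5 h6 => ?_⟩
      · rw [← e2]
        exact h3 t ht
      · have := h4 (t - (I + 1)) (by omega)
        rw [e3, Nat.sub_add_cancel h5] at this
        omega

/-- The weight `k + 1` splits into `1`, giving the binomial theorem, and `k`, giving its derivative.
-/
theorem sum_choose_mul_succ (b : ℕ) (x y : ℝ) :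
    ∑ k ∈ range (b + 1), (b.choose k : ℝ) * (x ^ k * ((k + 1) * y ^ (b - k))) =
      (x + y) ^ b + x * (b * (x + y) ^ (b - 1)) := by
  rw [← sum_choose_mul_pow_sub_one, add_pow, mul_sum, ← sum_add_distrib]
  refine sum_congr rfl fun k _ => ?_
  rcases k with _ | k
  · simp
  · rw [Nat.add_sub_cancel, pow_succ]
    push_cast
    ring

theorem card_isRecordPref {n : ℕ} (I J : Fin n) (hIJ : I ≤ J) :
    (Nat.card {f : Fin n → ℕ | IsRecordPref I J f} : ℝ) =
      ((J : ℕ).choose I : ℝ) * ((I : ℝ) + 1) ^ (I : ℕ) * ((n : ℝ) - I) ^ ((J : ℤ) - I - 1) *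
        (((n : ℝ) + 1) ^ (n - 1 - J) +
          ((I : ℝ) + 1) * ((n - 1 - J : ℕ) * ((n : ℝ) + 1) ^ (n - 1 - J - 1))) := by
  have hI0 : (I : ℝ) + 1 ≠ 0 := by positivity
  obtain ⟨a, ha⟩ := Nat.exists_eq_add_of_le (Fin.le_def.1 hIJ)
  obtain ⟨b, hb⟩ := Nat.exists_eq_add_of_lt J.2
  have hnJ : n - 1 - J = b := by omega
  have hnI : n - 1 - I = a + b := by omega
  have hn : (n : ℝ) = I + a + b + 1 := by
    have := congrArg (Nat.cast (R := ℝ)) hb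
    rw [this, ha]; push_cast; ring
  have hm : (n : ℝ) - I = ((a + b : ℕ) : ℝ) + 1 := by rw [hn]; push_cast; ring
  have hm0 : (n : ℝ) - I ≠ 0 := by rw [hm]; positivity
  rw [card_isRecordPref_eq_sum, Nat.cast_sum]
  have key : ∀ L : Finset (Fin n), ((Nat.card (recordLow I J L) *
      Nat.card {f : {x // x ∉ L} → ℕ | IsPark (n - 1 - I) f} : ℕ) : ℝ) =
      if J ∈ L ∧ #{c ∈ L | c < J} = I then
        ((I : ℝ) + 1) ^ ((I : ℤ) - 1) * ((I : ℝ) + 1) ^ (#L - I) *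
          (((n : ℝ) - I - (n - #L : ℕ)) * ((n : ℝ) - I) ^ (((n - #L : ℕ) : ℤ) - 1)) else 0 := by
    intro L
    split_ifs with h
    · have hc : Fintype.card {x // x ∉ L} = n - #L := by
        rw [Fintype.card_subtype_compl, Fintype.card_fin, Fintype.card_coe]
      have h1 : #{c ∈ L | c < J} < #L :=
        card_lt_card ((ssubset_iff_of_subset (filter_subset _ _)).2 ⟨J, h.1, by simp⟩)
      rw [Nat.cast_mul, card_recordLow I J L h, card_isPark_zpow _ (by omega), hc, hnI, ← hm]
    · have : recordLow I J L = ∅ := by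
        ext f
        simp only [Set.mem_empty_iff_false, iff_false]
        exact fun hf => h hf.2.1
      rw [this]
      simp
  rw [sum_congr rfl fun L _ => key L, ← sum_filter, sum_filter_card_eq (I : ℕ) J (fun l =>
    ((I : ℝ) + 1) ^ ((I : ℤ) - 1) * ((I : ℝ) + 1) ^ (l - I) *
      (((n : ℝ) - I - (n - l : ℕ)) * ((n : ℝ) - I) ^ (((n - l : ℕ) : ℤ) - 1))), hnJ]
  -- The two bases, `I + 1` for free cars of `L` and `n - I` for cars outside `L`, add up to `n +
  -- 1`.
  have hx : (n : ℝ) + 1 = ((I : ℝ) + 1) + (n - I) := by ring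
  rw [hx, ← sum_choose_mul_succ, mul_assoc, mul_assoc]
  congr 1
  rw [mul_sum, mul_sum]
  refine sum_congr rfl fun k hk => ?_
  have hkb : k ≤ b := Nat.lt_succ_iff.1 (mem_range.1 hk)
  have e1 : (I : ℕ) + 1 + k - I = k + 1 := by omega
  have e2 : n - (I + 1 + k) = a + (b - k) := by omega
  have e3 : (n : ℝ) - I - ((a + (b - k) : ℕ) : ℝ) = k + 1 := by
    rw [hn]; push_cast [hkb]; ring
  -- With `J = I + a`, the power `J - I - 1` does not depend on `k` and leaves the sum; it is `-1`
  -- when `I = J`.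
  have e4 : ((n : ℝ) - I) ^ (((a + (b - k) : ℕ) : ℤ) - 1) =
      ((n : ℝ) - I) ^ ((J : ℤ) - I - 1) * ((n : ℝ) - I) ^ (b - k) := by
    rw [← zpow_natCast (_ : ℝ) (b - k), ← zpow_add₀ hm0]
    congr 1
    push_cast [ha]
    ring
  have e5 : ((I : ℝ) + 1) ^ ((I : ℤ) - 1) * ((I : ℝ) + 1) ^ (k + 1) =
      ((I : ℝ) + 1) ^ (I : ℕ) * ((I : ℝ) + 1) ^ k := by
    rw [zpow_sub_one₀ hI0, zpow_natCast, pow_succ]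
    field_simp
  rw [e1, e2, e3, e4, e5]
  ring

/-! ### Probabilities and the expectation -/

theorem card_parkingFunction (n : ℕ) :
    (Fintype.card (ParkingFunction n) : ℝ) = ((n : ℝ) + 1) ^ ((n : ℤ) - 1) := by
  have h : Fintype.card (ParkingFunction n) = Nat.card {f : Fin n → ℕ | IsPark n f} := by
    rw [← Nat.card_eq_fintype_card]
    refine Nat.card_congr (Equiv.ofBijective
      (fun p => ⟨fun c => (p.1 c : ℕ), (isParkingFunction_iff p.1).1 p.2⟩) ⟨?_, ?_⟩)
    · intro p q h
      ext c
      exact congrFun (congrArg Subtype.val h) c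
    · rintro ⟨f, hf⟩
      exact ⟨⟨fun c => ⟨f c, hf.lt c⟩, (isParkingFunction_iff _).2 hf⟩, rfl⟩
  rw [h, card_isPark_zpow n (by simp)]
  simp

theorem card_record_event {n : ℕ} (I J : Fin n) :
    Nat.card {p : ParkingFunction n | IsLRMax (toPerm p) I ∧ toPerm p I = J} =
      Nat.card {f : Fin n → ℕ | IsRecordPref I J f} := by
  refine Nat.card_congr (Equiv.ofBijective (fun p => ⟨fun c => (p.1.1 c : ℕ),
    (isRecordPref_iff p.1.1 I J).2 ⟨p.1.2, p.2⟩⟩) ⟨?_, ?_⟩)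
  · intro p q h
    ext c
    exact congrFun (congrArg Subtype.val h) c
  · rintro ⟨f, hf⟩
    have hlt : ∀ c, f c < n := by
      intro c
      by_contra hx
      have h1 := hf.2.2.2 n I.2 le_rfl
      have : 0 < #{x | n ≤ f x} := card_pos.2 ⟨c, by simpa using hx⟩
      omega
    obtain ⟨h, h'⟩ := (isRecordPref_iff (fun c => ⟨f c, hlt c⟩) I J).1 hf
    exact ⟨⟨⟨fun c => ⟨f c, hlt c⟩, h⟩, h'⟩, rfl⟩

theorem parkMeasure_real_eq (n : ℕ) (s : Set (Equiv.Perm (Fin n))) :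
    (parkMeasure n).real s =
      (Nat.card (toPerm ⁻¹' s : Set (ParkingFunction n)) : ℝ) /
        Fintype.card (ParkingFunction n) := by
  classical
  have hs : MeasurableSet s := trivial
  rw [MeasureTheory.measureReal_def, parkMeasure,
    PMF.toMeasure_apply_eq_toOuterMeasure_apply _ hs, parkPMF, PMF.toOuterMeasure_map_apply,
    PMF.toOuterMeasure_uniformOfFintype_apply, ENNReal.toReal_div, Nat.card_eq_fintype_card]
  simp

theorem parkMeasure_record {n : ℕ} (I J : Fin n) (hIJ : I ≤ J) :
    (parkMeasure n).real {σ | IsLRMax σ I ∧ σ I = J} =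
      ((J : ℕ).choose I : ℝ) * ((I : ℝ) + 1) ^ (I : ℕ) * ((n : ℝ) - I) ^ ((J : ℤ) - I - 1) *
        (((I : ℝ) + 1) * ((n : ℝ) - (J + 1)) * ((n : ℝ) + 1) ^ (-((J : ℤ) + 1)) +
          ((n : ℝ) + 1) ^ (-(J : ℤ))) := by
  have hn : (n : ℝ) + 1 ≠ 0 := by positivity
  rw [parkMeasure_real_eq, card_parkingFunction]
  have h := card_record_event I J
  rw [show toPerm ⁻¹' {σ | IsLRMax σ I ∧ σ I = J} =
    {p : ParkingFunction n | IsLRMax (toPerm p) I ∧ toPerm p I = J} from rfl, h,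
    card_isRecordPref I J hIJ, mul_div_assoc]
  congr 1
  obtain ⟨b, hb⟩ := Nat.exists_eq_add_of_lt J.2
  have hnJ : n - 1 - J = b := by omega
  have hb' : (n : ℝ) - (J + 1) = b := by
    have := congrArg (Nat.cast (R := ℝ)) hb
    push_cast at this
    linarith
  have hz : (n : ℤ) - 1 = J + b := by omega
  rw [hnJ, hb', hz, zpow_neg, zpow_neg, zpow_add_one₀ hn, zpow_add₀ hn, zpow_natCast, zpow_natCast]
  -- For `b = 0` the truncated exponent `b - 1` is harmless, since its term carries the factor `b`.
  rcases b with _ | b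
  · simp
  · rw [Nat.add_sub_cancel, pow_succ]
    field_simp
    ring

/-- The values at the positions before `i` are distinct and all smaller than `σ i`. -/
theorem IsLRMax.le_apply {n : ℕ} {σ : Equiv.Perm (Fin n)} {i : Fin n} (h : IsLRMax σ i) :
    i ≤ σ i := by
  have : #((Iio i).map σ.toEmbedding) ≤ #(Iio (σ i)) := by
    refine card_le_card fun c hc => ?_
    simp only [mem_map, mem_Iio, Equiv.coe_toEmbedding] at hc ⊢
    obtain ⟨k, hk, rfl⟩ := hc
    exact h k hk
  rwa [card_map, Fin.card_Iio, Fin.card_Iio] at this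

/-- Each left-to-right maximum `I` is counted once, at `J = σ I`; `IsLRMax.le_apply` discards the
pairs with `I > J`. -/
theorem lrMaxCount_eq_sum {n : ℕ} (σ : Equiv.Perm (Fin n)) :
    (lrMaxCount σ : ℝ) = ∑ J : Fin n, ∑ I ∈ Iic J,
      Set.indicator {σ : Equiv.Perm (Fin n) | IsLRMax σ I ∧ σ I = J} 1 σ := by
  have h : ∀ J : Fin n, ∑ I ∈ Iic J,
      Set.indicator {σ : Equiv.Perm (Fin n) | IsLRMax σ I ∧ σ I = J} (1 : Equiv.Perm (Fin n) → ℝ) σ =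
      ∑ I : Fin n, if IsLRMax σ I ∧ σ I = J then 1 else 0 := by
    intro J
    simp only [Set.indicator_apply, Set.mem_ofPred_eq, Pi.one_apply]
    refine sum_subset (subset_univ _) fun I _ hI => if_neg ?_
    rintro ⟨h1, rfl⟩
    exact hI (mem_Iic.2 h1.le_apply)
  rw [sum_congr rfl fun J _ => h J, sum_comm, lrMaxCount, card_filter]
  push_cast
  refine sum_congr rfl fun I _ => ?_
  by_cases hI : IsLRMax σ I <;> simp [hI]

theorem integral_lrMaxCount (n : ℕ) :
    ∫ σ, (lrMaxCount σ : ℝ) ∂(parkMeasure n) =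
      ∑ J : Fin n, ∑ I ∈ Iic J, (parkMeasure n).real {σ | IsLRMax σ I ∧ σ I = J} := by
  have : MeasureTheory.IsProbabilityMeasure (parkMeasure n) :=
    inferInstanceAs (MeasureTheory.IsProbabilityMeasure (parkPMF n).toMeasure)
  have hinteg : ∀ I J : Fin n, MeasureTheory.Integrable
      (Set.indicator {σ : Equiv.Perm (Fin n) | IsLRMax σ I ∧ σ I = J} (1 : Equiv.Perm (Fin n) → ℝ))
      (parkMeasure n) := fun I J =>
    (MeasureTheory.integrable_const (1 : ℝ)).indicator (MeasurableSpace.measurableSet_top)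
  simp only [lrMaxCount_eq_sum]
  rw [MeasureTheory.integral_finsetSum _ fun J _ =>
    MeasureTheory.integrable_finsetSum _ fun I _ => hinteg I J]
  refine sum_congr rfl fun J _ => ?_
  rw [MeasureTheory.integral_finsetSum _ fun I _ => hinteg I J]
  exact sum_congr rfl fun I _ => MeasureTheory.integral_indicator_one trivial

theorem sum_Icc_Icc_eq (n : ℕ) (F : ℕ → ℕ → ℝ) :
    ∑ j ∈ Icc 1 n, ∑ i ∈ Icc 1 j, F i j =
      ∑ J : Fin n, ∑ I ∈ Iic J, F (I + 1) (J + 1) := by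
  have hI : ∀ J : Fin n, ∑ I ∈ Iic J, F (I + 1) (J + 1) = ∑ i ∈ Icc 1 (J + 1 : ℕ), F i (J + 1) := by
    intro J
    refine sum_bij (fun I _ => (I : ℕ) + 1) ?_ ?_ ?_ ?_
    · intro I h
      have := Fin.le_def.1 (mem_Iic.1 h)
      simpa using this
    · intro I _ I' _ h
      exact Fin.ext (Nat.succ_injective h)
    · intro i h
      have hi := mem_Icc.1 h
      exact ⟨⟨i - 1, by omega⟩, mem_Iic.2 (Fin.le_def.2 (by dsimp only; omega)),
        by dsimp only; omega⟩
    · exact fun _ _ => rfl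
  rw [sum_congr rfl fun J _ => hI J,
    Fin.sum_univ_eq_sum_range (fun J => ∑ i ∈ Icc 1 (J + 1), F i (J + 1)) n]
  rw [range_eq_Ico, sum_Ico_add' (fun j => ∑ i ∈ Icc 1 j, F i j) 0 n 1]
  rfl

end Parking

theorem theorem1p14 (n : ℕ) :
    (∀ (i j : ℕ) (hi : 1 ≤ i) (hij : i ≤ j) (hj : j ≤ n),
      (Parking.parkMeasure n).real
        {σ : Equiv.Perm (Fin n) | Parking.IsLRMax σ ⟨i - 1, by omega⟩ ∧
          σ ⟨i - 1, by omega⟩ = ⟨j - 1, by omega⟩} =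
      ((j - 1).choose (i - 1) : ℝ) * (i : ℝ) ^ (i - 1)
        * ((n : ℝ) - i + 1) ^ ((j : ℤ) - i - 1)
        * ((i : ℝ) * ((n : ℝ) - j) * ((n : ℝ) + 1) ^ (-(j : ℤ))
            + ((n : ℝ) + 1) ^ (1 - (j : ℤ)))) ∧
    ∫ σ, (Parking.lrMaxCount σ : ℝ) ∂(Parking.parkMeasure n) =
      ∑ j ∈ Finset.Icc 1 n, ∑ i ∈ Finset.Icc 1 j,
        ((j - 1).choose (i - 1) : ℝ) * (i : ℝ) ^ (i - 1)
          * ((n : ℝ) - i + 1) ^ ((j : ℤ) - i - 1)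
          * ((i : ℝ) * ((n : ℝ) - j) * ((n : ℝ) + 1) ^ (-(j : ℤ))
              + ((n : ℝ) + 1) ^ (1 - (j : ℤ))) := by
  have key : ∀ (i j : ℕ) (hi : 1 ≤ i) (hij : i ≤ j) (hj : j ≤ n),
      (Parking.parkMeasure n).real
        {σ : Equiv.Perm (Fin n) | Parking.IsLRMax σ ⟨i - 1, by omega⟩ ∧
          σ ⟨i - 1, by omega⟩ = ⟨j - 1, by omega⟩} =
      ((j - 1).choose (i - 1) : ℝ) * (i : ℝ) ^ (i - 1)
        * ((n : ℝ) - i + 1) ^ ((j : ℤ) - i - 1)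
        * ((i : ℝ) * ((n : ℝ) - j) * ((n : ℝ) + 1) ^ (-(j : ℤ))
            + ((n : ℝ) + 1) ^ (1 - (j : ℤ))) := by
    intro i j hi hij hj
    rw [Parking.parkMeasure_record _ _ (Fin.le_def.2 (Nat.sub_le_sub_right hij 1))]
    -- Passing from the 1-based `i`, `j` to the 0-based indices of `Fin n`.
    obtain ⟨I, rfl⟩ := Nat.exists_eq_add_one.2 hi
    obtain ⟨J, rfl⟩ := Nat.exists_eq_add_one.2 (hi.trans hij)
    simp only [Nat.add_sub_cancel]
    push_cast
    have e1 : (n : ℝ) - (I + 1) + 1 = n - I := by ring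
    have e2 : (J : ℤ) + 1 - (I + 1) - 1 = J - I - 1 := by ring
    have e3 : 1 - ((J : ℤ) + 1) = -J := by ring
    rw [e1, e2, e3]
  refine ⟨key, ?_⟩
  rw [Parking.integral_lrMaxCount, Parking.sum_Icc_Icc_eq n (fun i j =>
    ((j - 1).choose (i - 1) : ℝ) * (i : ℝ) ^ (i - 1) * ((n : ℝ) - i + 1) ^ ((j : ℤ) - i - 1)
      * ((i : ℝ) * ((n : ℝ) - j) * ((n : ℝ) + 1) ^ (-(j : ℤ)) + ((n : ℝ) + 1) ^ (1 - (j : ℤ))))]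
  refine Finset.sum_congr rfl fun J _ => Finset.sum_congr rfl fun I hI => ?_
  exact key (I + 1) (J + 1) (Nat.le_add_left 1 I)
    (Nat.succ_le_succ (Fin.le_def.1 (Finset.mem_Iic.1 hI))) J.2
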